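/- Let $\Gamma$ be a finite set with at least two elements, let $0<r<1$ and $\lambda_i\in\mathbb R$ ($i\in\Gamma$), and let $f_i(x)=rx+\lambda_i$, a homogeneous affine iterated function system on $\mathbb R$. Write $f_{\mathtt i}=f_{i_1}\circ\cdots\circ f_{i_n}$ for $\mathtt i=(i_1,\dots,i_n)\in\Gamma^n$. Suppose that the system satisfies the weak separation condition: there is $c>0$ such that for all $n\ge 1$ and all $\mathtt i,\mathtt j\in\Gamma^n$, either $f_{\mathtt i}(0)=f_{\mathtt j}(0)$ or $|f_{\mathtt i}(0)-f_{\mathtt j}(0)|>c\,r^n$. Let $K$ be the attractor, i.e. the unique nonempty compact set with $K=\bigcup_{i\in\Gamma}f_i(K)$, and let $\pi:\Gamma^{\mathbb N}\to K$, $\pi(i_1,i_2,\dots)=\lim_{k\to\infty}f_{i_1}\circ\cdots\circ f_{i_k}(0)$, be the natural coding map. Let $\nu$ be a Borel probability measure on $\Gamma^{\mathbb N}$ that is invariant under the left shift, and let $\mu=\pi\nu=\nu\circ\pi^{-1}$. For a probability measure $\mu$ on $\mathbb R$, let $H_n(\mu)=-\sum_{Q}\mu(Q)\log_2\mu(Q)$,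 where $Q$ runs over the dyadic intervals $[k2^{-n},(k+1)2^{-n})$, $k\in\mathbb Z$, and let $\dim\mu=\liminf_{n\to\infty}H_n(\mu)/n$ be the (lower) entropy dimension of $\mu$. If $\dim\mu=\dim_{\rm H}K=s$, where $\dim_{\rm H}$ denotes Hausdorff dimension, then $\mu$ is absolutely continuous with respect to the $s$-dimensional Hausdorff measure $\mathcal H^s$ on $\mathbb R$. -/

import Mathlib

open MeasureTheory Filter Topology
open scoped ENNReal NNReal

noncomputable section

/-- A homogeneous affine iterated function system `x ↦ r * x + t i`, `i ∈ Γ`, on the real line,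
with a common contraction ratio `0 < r < 1`. -/
structure HomogeneousAffineIFS (Γ : Type*) where
  ratio : ℝ
  ratio_pos : 0 < ratio
  ratio_lt_one : ratio < 1
  translation : Γ → ℝ

namespace HomogeneousAffineIFS

/-- The contraction `f_i`. -/
def map {Γ : Type*} (F : HomogeneousAffineIFS Γ) (i : Γ) (x : ℝ) : ℝ :=
  F.ratio * x + F.translation i

/-- The composition `f_{i_1} ∘ ⋯ ∘ f_{i_n}` along a finite word. -/
def wordMap {Γ : Type*} (F : HomogeneousAffineIFS Γ) : List Γ → ℝ → ℝ
  | [] => id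
  | i :: w => F.map i ∘ F.wordMap w

/-- `K` is the attractor: the (unique) nonempty compact set with `K = ⋃ i, f_i(K)`. -/
def IsAttractor {Γ : Type*} (F : HomogeneousAffineIFS Γ) (K : Set ℝ) : Prop :=
  K.Nonempty ∧ IsCompact K ∧ K = ⋃ i, F.map i '' K

/-- The weak separation condition: there is `c > 0` such that, for all words `u`, `v` of the same
length `n ≥ 1`, the points `f_u(0)` and `f_v(0)` are equal or more than `c * r ^ n` apart. -/
def WeakSeparation {Γ : Type*} (F : HomogeneousAffineIFS Γ) : Prop :=
  ∃ c : ℝ, 0 < c ∧ ∀ n : ℕ, 1 ≤ n → ∀ u v : Fin n → Γ,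
    |F.wordMap (List.ofFn u) 0 - F.wordMap (List.ofFn v) 0| = 0 ∨
      c * F.ratio ^ n < |F.wordMap (List.ofFn u) 0 - F.wordMap (List.ofFn v) 0|

/-- The natural coding map `π(i) = lim_k f_{i_1} ⋯ f_{i_k}(0)`. -/
def coding {Γ : Type*} (F : HomogeneousAffineIFS Γ) (i : ℕ → Γ) : ℝ :=
  limUnder atTop fun k : ℕ => F.wordMap (List.ofFn fun j : Fin k => i j) 0

theorem wordMap_append {Γ : Type*} (F : HomogeneousAffineIFS Γ) (u : List Γ) (a : Γ) :
    F.wordMap (u ++ [a]) 0 = F.wordMap u 0 + F.translation a * F.ratio ^ u.length := by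
  induction u with
  | nil => simp [wordMap, map]
  | cons b u ih => simp [wordMap, map, ih]; ring

theorem wordMap_ofFn {Γ : Type*} (F : HomogeneousAffineIFS Γ) (i : ℕ → Γ) (k : ℕ) :
    F.wordMap (List.ofFn fun j : Fin k => i j) 0 =
      ∑ j ∈ Finset.range k, F.translation (i j) * F.ratio ^ j := by
  induction k with
  | zero => simp [wordMap]
  | succ k ih =>
    rw [List.ofFn_succ', List.concat_eq_append, wordMap_append, Finset.sum_range_succ, ← ih]
    simp

/-- The limit defining the coding map exists. -/
theorem tendsto_coding {Γ : Type*} [Finite Γ] (F : HomogeneousAffineIFS Γ) (i : ℕ → Γ) :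
    Tendsto (fun k : ℕ => F.wordMap (List.ofFn fun j : Fin k => i j) 0) atTop
      (𝓝 (F.coding i)) := by
  apply tendsto_nhds_limUnder
  obtain ⟨C, hC⟩ := (Set.finite_range fun a => |F.translation a|).bddAbove
  have hs : Summable fun j : ℕ => F.translation (i j) * F.ratio ^ j := by
    refine Summable.of_norm_bounded
      ((summable_geometric_of_lt_one F.ratio_pos.le F.ratio_lt_one).mul_left C) fun j => ?_
    rw [norm_mul, norm_pow, Real.norm_eq_abs, Real.norm_eq_abs, abs_of_pos F.ratio_pos]
    exact mul_le_mul_of_nonneg_right (hC ⟨i j, rfl⟩) (pow_nonneg F.ratio_pos.le j)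
  refine ⟨∑' j, F.translation (i j) * F.ratio ^ j, ?_⟩
  simp only [wordMap_ofFn]
  exact hs.hasSum.tendsto_sum_nat

/-- The coding map is measurable, so push-forwards along it are genuine. -/
theorem measurable_coding {Γ : Type*} [Finite Γ] [MeasurableSpace Γ] [DiscreteMeasurableSpace Γ]
    (F : HomogeneousAffineIFS Γ) : Measurable F.coding := by
  refine measurable_of_tendsto_metrizable (fun k => ?_)
    (tendsto_pi_nhds.2 fun i => F.tendsto_coding i)
  simp only [wordMap_ofFn]
  refine Finset.measurable_fun_sum _ fun j _ => Measurable.mul_const ?_ _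
  exact (Measurable.of_discrete (f := F.translation)).comp (measurable_pi_apply j)

end HomogeneousAffineIFS

/-- The left shift on `Γ^ℕ`. -/
def leftShift {Γ : Type*} (i : ℕ → Γ) : ℕ → Γ := fun n => i (n + 1)

/-- The half-open dyadic interval `[k 2⁻ⁿ, (k + 1) 2⁻ⁿ)`. -/
def dyadicInterval (n : ℕ) (k : ℤ) : Set ℝ :=
  Set.Ico ((k : ℝ) / 2 ^ n) (((k : ℝ) + 1) / 2 ^ n)

/-- The `n`-scale entropy of a probability measure on `ℝ`: its Shannon entropy, with logarithms to
base `2`, for the partition into dyadic intervals of length `2⁻ⁿ`. Each summand `-p log₂ p` is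
nonnegative, since `0 ≤ p ≤ 1`. -/
def scaleEntropy (μ : Measure ℝ) (n : ℕ) : ℝ≥0∞ :=
  ∑' k : ℤ, ENNReal.ofReal
    (-(μ.real (dyadicInterval n k) * Real.logb 2 (μ.real (dyadicInterval n k))))

/-- The (lower) entropy dimension of a probability measure on `ℝ`. -/
def entropyDim (μ : Measure ℝ) : ℝ≥0∞ :=
  liminf (fun n : ℕ => scaleEntropy μ n / (n : ℝ≥0∞)) atTop

end

/-!
Let `N_n` be the number of points `f_u(0)` with `u` a word of length `n`, and let `r` be the
contraction ratio. Weak separation makes `N_n` supermultiplicative up to a constant, because only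
boundedly many points of level `m` lie within a bounded multiple of `r ^ m` of a given point. An
economical cover of `K` in dimension `t > s` gives a renewal inequality which shows that
`N_n r ^ (n t)` is bounded, and supermultiplicativity then makes the bound independent of `t`;
letting `t → s`, `N_n ≤ M r ^ (-n s)`. Hence a compact `ℋ^s`-null set `A` is approached, at a
suitable level `n`, by at most `δ r ^ (-n s)` points, with `δ` arbitrarily small.

On the other hand the entropy of the position `f_{i_1} ⋯ f_{i_n}(0)` is subadditive in `n`, as `ν`
is shift invariant, and it determines the entropies of `μ` at dyadic scales up to a bounded error.
So `dim μ = s` forces this entropy to be at least `n s log (1 / r)` at *every* level `n`, within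
`log M` of its largest possible value. Such a distribution cannot give much mass to few
points: comparing entropies gives `μ(A) log (1 / δ) ≤ log (2 M)`, and `δ → 0` yields `μ(A) = 0`.
-/

section Entropy

open Real

theorem negMulLog_sum_le {ι : Type*} (T : Finset ι) {w : ι → ℝ} (hw : ∀ i ∈ T, 0 ≤ w i) :
    negMulLog (∑ i ∈ T, w i) ≤ ∑ i ∈ T, negMulLog (w i) := by
  rw [negMulLog, ← Finset.sum_neg_distrib, Finset.sum_mul]
  refine Finset.sum_le_sum fun i hi => ?_
  rw [negMulLog, neg_mul, neg_mul, neg_le_neg_iff]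
  rcases (hw i hi).eq_or_lt with h | h
  · simp [← h]
  · exact mul_le_mul_of_nonneg_left (log_le_log h (Finset.single_le_sum hw hi)) h.le

theorem sum_negMulLog_le_log_card {ι : Type*} {T : Finset ι} {w : ι → ℝ}
    (hw : ∀ i ∈ T, 0 ≤ w i) (hw1 : ∑ i ∈ T, w i = 1) :
    ∑ i ∈ T, negMulLog (w i) ≤ log T.card := by
  have hT : (0 : ℝ) < T.card := by
    rw [Nat.cast_pos, Finset.card_pos]
    exact Finset.nonempty_of_sum_ne_zero (hw1.trans_ne one_ne_zero)
  have jensen : ∑ i ∈ T, (T.card : ℝ)⁻¹ * negMulLog (w i) ≤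
      negMulLog (∑ i ∈ T, (T.card : ℝ)⁻¹ * w i) :=
    concaveOn_negMulLog.le_map_sum (fun _ _ => by positivity)
      (by rw [Finset.sum_const, nsmul_eq_mul, mul_inv_cancel₀ hT.ne']) hw
  rw [← Finset.mul_sum, ← Finset.mul_sum, hw1, mul_one, negMulLog, log_inv, neg_mul_neg] at jensen
  exact le_of_mul_le_mul_left jensen (inv_pos.2 hT)

theorem log_natCast_le_log_natCast {m n : ℕ} (h : m ≤ n) : log m ≤ log n := by
  rcases m.eq_zero_or_pos with rfl | hm
  · simpa using log_natCast_nonneg n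
  · exact log_le_log (Nat.cast_pos.2 hm) (Nat.cast_le.2 h)

variable {Ω Ω' α β γ : Type*} [MeasurableSpace Ω] [MeasurableSpace Ω']

/-- The Shannon entropy, in nats, of a discrete random variable `X`. It is only used for variables
taking almost surely finitely many values: a divergent series would have the junk value `0`. -/
noncomputable def shannonEntropy (ν : Measure Ω) (X : Ω → α) : ℝ :=
  ∑' x, negMulLog (ν.real (X ⁻¹' {x}))

section

variable {ν : Measure Ω} {X : Ω → α} {Y : Ω → β} {P : Finset α} {Q : Finset β}

theorem measureReal_preimage_singleton_eq_zero (hP : ∀ᵐ ω ∂ν, X ω ∈ P) {x : α} (hx : x ∉ P) :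
    ν.real (X ⁻¹' {x}) = 0 := by
  rw [measureReal_def, measure_mono_null _ hP, ENNReal.toReal_zero]
  rintro ω rfl
  exact hx

theorem shannonEntropy_eq_sum (hP : ∀ᵐ ω ∂ν, X ω ∈ P) :
    shannonEntropy ν X = ∑ x ∈ P, negMulLog (ν.real (X ⁻¹' {x})) :=
  tsum_eq_sum fun x hx => by
    rw [measureReal_preimage_singleton_eq_zero hP hx, negMulLog_zero]

theorem shannonEntropy_nonneg [IsProbabilityMeasure ν] : 0 ≤ shannonEntropy ν X :=
  tsum_nonneg fun _ => negMulLog_nonneg measureReal_nonneg measureReal_le_one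

theorem shannonEntropy_comp_measurePreserving [MeasurableSpace α] [MeasurableSingletonClass α]
    {ν' : Measure Ω'} {T : Ω' → Ω} (hT : MeasurePreserving T ν' ν) (hX : Measurable X) :
    shannonEntropy ν' (X ∘ T) = shannonEntropy ν X :=
  tsum_congr fun x => by
    rw [Set.preimage_comp,
      hT.measureReal_preimage (hX (measurableSet_singleton x)).nullMeasurableSet]

variable [MeasurableSpace α] [MeasurableSingletonClass α]

theorem sum_measureReal_inter_preimage_singleton [IsFiniteMeasure ν] (hX : Measurable X)
    (hP : ∀ᵐ ω ∂ν, X ω ∈ P) (E : Set Ω) :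
    ∑ x ∈ P, ν.real (X ⁻¹' {x} ∩ E) = ν.real E := by
  have hmeas : ∀ x, MeasurableSet (X ⁻¹' {x}) := fun x => hX (measurableSet_singleton x)
  calc ∑ x ∈ P, ν.real (X ⁻¹' {x} ∩ E)
      = ∑ x ∈ P, (ν.restrict E).real (X ⁻¹' {x}) :=
        Finset.sum_congr rfl fun x _ => (measureReal_restrict_apply (hmeas x)).symm
    _ = (ν.restrict E).real (X ⁻¹' P) := sum_measureReal_preimage_singleton P fun x _ => hmeas x
    _ = (ν.restrict E).real Set.univ :=
        measureReal_congr (eventuallyEq_univ.2 (ae_restrict_of_ae hP))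
    _ = ν.real E := by rw [measureReal_restrict_apply MeasurableSet.univ, Set.univ_inter]

theorem sum_measureReal_preimage_singleton_eq_one [IsProbabilityMeasure ν] (hX : Measurable X)
    (hP : ∀ᵐ ω ∂ν, X ω ∈ P) : ∑ x ∈ P, ν.real (X ⁻¹' {x}) = 1 := by
  simpa using sum_measureReal_inter_preimage_singleton hX hP Set.univ

theorem shannonEntropy_le_log_card [IsProbabilityMeasure ν] (hX : Measurable X)
    (hP : ∀ᵐ ω ∂ν, X ω ∈ P) : shannonEntropy ν X ≤ log P.card := by
  rw [shannonEntropy_eq_sum hP]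
  exact sum_negMulLog_le_log_card (fun _ _ => measureReal_nonneg)
    (sum_measureReal_preimage_singleton_eq_one hX hP)

theorem shannonEntropy_comp_le [IsFiniteMeasure ν] (hX : Measurable X) (hP : ∀ᵐ ω ∂ν, X ω ∈ P)
    (g : α → γ) : shannonEntropy ν (fun ω => g (X ω)) ≤ shannonEntropy ν X := by
  classical
  have hfiber : ∀ z, ν.real ((fun ω => g (X ω)) ⁻¹' {z}) =
      ∑ x ∈ P with g x = z, ν.real (X ⁻¹' {x}) := by
    intro z
    rw [sum_measureReal_preimage_singleton _ fun x _ => hX (measurableSet_singleton x)]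
    refine measureReal_congr (eventuallyEq_set.2 ?_)
    filter_upwards [hP] with ω hω
    simp [hω]
  rw [shannonEntropy_eq_sum (P := P.image g) (hP.mono fun ω => Finset.mem_image_of_mem g),
    shannonEntropy_eq_sum hP,
    ← Finset.sum_fiberwise_of_maps_to fun x hx => Finset.mem_image_of_mem g hx]
  refine Finset.sum_le_sum fun z _ => ?_
  rw [hfiber]
  exact negMulLog_sum_le _ fun _ _ => measureReal_nonneg

variable [MeasurableSpace β] [MeasurableSingletonClass β]

theorem measureReal_mul_cond_preimage [IsFiniteMeasure ν] (hX : Measurable X) (x : α)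
    (E : Set Ω) :
    ν.real (X ⁻¹' {x}) * (ProbabilityTheory.cond ν (X ⁻¹' {x})).real E =
      ν.real (X ⁻¹' {x} ∩ E) := by
  rw [measureReal_def, measureReal_def, measureReal_def, mul_comm, ← ENNReal.toReal_mul,
    ProbabilityTheory.cond_mul_eq_inter (hX (measurableSet_singleton x))]

theorem shannonEntropy_prodMk [IsFiniteMeasure ν] (hX : Measurable X) (hY : Measurable Y)
    (hP : ∀ᵐ ω ∂ν, X ω ∈ P) (hQ : ∀ᵐ ω ∂ν, Y ω ∈ Q) :
    shannonEntropy ν (fun ω => (X ω, Y ω)) = shannonEntropy ν X +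
      ∑ x ∈ P, ν.real (X ⁻¹' {x}) *
        shannonEntropy (ProbabilityTheory.cond ν (X ⁻¹' {x})) Y := by
  have hPQ : ∀ᵐ ω ∂ν, (X ω, Y ω) ∈ P ×ˢ Q := by
    filter_upwards [hP, hQ] with ω hω hω' using Finset.mk_mem_product hω hω'
  rw [shannonEntropy_eq_sum hPQ, shannonEntropy_eq_sum hP, Finset.sum_product,
    ← Finset.sum_add_distrib]
  refine Finset.sum_congr rfl fun x _ => ?_
  set κ := ProbabilityTheory.cond ν (X ⁻¹' {x}) with hκ
  have hκQ : ∀ᵐ ω ∂κ, Y ω ∈ Q := ProbabilityTheory.cond_absolutelyContinuous.ae_le hQ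
  have hpair : ∀ y, ν.real ((fun ω => (X ω, Y ω)) ⁻¹' {(x, y)}) =
      ν.real (X ⁻¹' {x}) * κ.real (Y ⁻¹' {y}) := by
    intro y
    rw [hκ, measureReal_mul_cond_preimage hX, ← Set.singleton_prod_singleton, Set.mk_preimage_prod]
  have htotal : (∑ y ∈ Q, κ.real (Y ⁻¹' {y})) * negMulLog (ν.real (X ⁻¹' {x})) =
      negMulLog (ν.real (X ⁻¹' {x})) := by
    rcases eq_or_ne (ν (X ⁻¹' {x})) 0 with h | h
    · simp [measureReal_def, h]
    · have := ProbabilityTheory.cond_isProbabilityMeasure h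
      rw [sum_measureReal_preimage_singleton_eq_one hY hκQ, one_mul]
  simp only [hpair, negMulLog_mul, Finset.sum_add_distrib, ← Finset.sum_mul, ← Finset.mul_sum,
    htotal, shannonEntropy_eq_sum hκQ]

theorem shannonEntropy_prodMk_le_add [IsProbabilityMeasure ν] (hX : Measurable X)
    (hY : Measurable Y) (hP : ∀ᵐ ω ∂ν, X ω ∈ P) (hQ : ∀ᵐ ω ∂ν, Y ω ∈ Q) :
    shannonEntropy ν (fun ω => (X ω, Y ω)) ≤ shannonEntropy ν X + shannonEntropy ν Y := by
  have hκQ : ∀ x, ∀ᵐ ω ∂(ProbabilityTheory.cond ν (X ⁻¹' {x})), Y ω ∈ Q := fun x =>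
    ProbabilityTheory.cond_absolutelyContinuous.ae_le hQ
  rw [shannonEntropy_prodMk hX hY hP hQ, shannonEntropy_eq_sum (X := Y) hQ]
  refine add_le_add_right ?_ _
  simp only [fun x => shannonEntropy_eq_sum (hκQ x), Finset.mul_sum]
  rw [Finset.sum_comm]
  refine Finset.sum_le_sum fun y _ => ?_
  have jensen := concaveOn_negMulLog.le_map_sum (t := P) (w := fun x => ν.real (X ⁻¹' {x}))
    (p := fun x => (ProbabilityTheory.cond ν (X ⁻¹' {x})).real (Y ⁻¹' {y}))
    (fun _ _ => measureReal_nonneg) (sum_measureReal_preimage_singleton_eq_one hX hP)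
    fun _ _ => measureReal_nonneg
  simpa only [smul_eq_mul, measureReal_mul_cond_preimage hX,
    sum_measureReal_inter_preimage_singleton hX hP] using jensen

theorem shannonEntropy_le_add_sum_mul_log_card [IsProbabilityMeasure ν] (hX : Measurable X)
    (hY : Measurable Y) (hP : ∀ᵐ ω ∂ν, X ω ∈ P) (T : α → Finset β)
    (hT : ∀ᵐ ω ∂ν, Y ω ∈ T (X ω)) :
    shannonEntropy ν Y ≤
      shannonEntropy ν X + ∑ x ∈ P, ν.real (X ⁻¹' {x}) * log (T x).card := by
  classical
  have hQ : ∀ᵐ ω ∂ν, Y ω ∈ P.biUnion T := by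
    filter_upwards [hP, hT] with ω hω hω' using Finset.mem_biUnion.2 ⟨_, hω, hω'⟩
  have hPQ : ∀ᵐ ω ∂ν, (X ω, Y ω) ∈ P ×ˢ P.biUnion T := by
    filter_upwards [hP, hQ] with ω hω hω' using Finset.mk_mem_product hω hω'
  refine (shannonEntropy_comp_le (hX.prodMk hY) hPQ Prod.snd).trans ?_
  rw [shannonEntropy_prodMk hX hY hP hQ]
  refine add_le_add_right (Finset.sum_le_sum fun x _ => ?_) _
  rcases eq_or_ne (ν (X ⁻¹' {x})) 0 with h | h
  · simp [measureReal_def, h]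
  · have := ProbabilityTheory.cond_isProbabilityMeasure h
    refine mul_le_mul_of_nonneg_left (shannonEntropy_le_log_card hY ?_) measureReal_nonneg
    filter_upwards [ProbabilityTheory.ae_cond_mem (hX (measurableSet_singleton x)),
      ProbabilityTheory.cond_absolutelyContinuous.ae_le hT] with ω hω hω'
    rwa [← show X ω = x from hω]

theorem shannonEntropy_le_add_log [IsProbabilityMeasure ν] (hX : Measurable X)
    (hY : Measurable Y) (hP : ∀ᵐ ω ∂ν, X ω ∈ P) (T : α → Finset β)
    (hT : ∀ᵐ ω ∂ν, Y ω ∈ T (X ω)) {D : ℕ} (hD : ∀ x, (T x).card ≤ D) :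
    shannonEntropy ν Y ≤ shannonEntropy ν X + log D :=
  calc shannonEntropy ν Y
      ≤ shannonEntropy ν X + ∑ x ∈ P, ν.real (X ⁻¹' {x}) * log (T x).card :=
        shannonEntropy_le_add_sum_mul_log_card hX hY hP T hT
    _ ≤ shannonEntropy ν X + ∑ x ∈ P, ν.real (X ⁻¹' {x}) * log D := by
        refine add_le_add_right (Finset.sum_le_sum fun x _ => ?_) _
        exact mul_le_mul_of_nonneg_left (log_natCast_le_log_natCast (hD x)) measureReal_nonneg
    _ = shannonEntropy ν X + log D := by
        rw [← Finset.sum_mul, sum_measureReal_preimage_singleton_eq_one hX hP, one_mul]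

theorem shannonEntropy_le_log_two_add [IsProbabilityMeasure ν] (hX : Measurable X)
    (hP : ∀ᵐ ω ∂ν, X ω ∈ P) (S : Finset α) :
    shannonEntropy ν X ≤
      log 2 + (ν.real (X ⁻¹' S) * log S.card + (1 - ν.real (X ⁻¹' S)) * log P.card) := by
  classical
  have hS : MeasurableSet (X ⁻¹' S) := hX S.measurableSet
  let Z : Ω → Bool := fun ω => decide (X ω ∈ S)
  have htrue : Z ⁻¹' {true} = X ⁻¹' S := by ext; simp [Z]
  have hZ : Measurable Z := measurable_to_bool (htrue ▸ hS)
  have hfalse : ν.real (Z ⁻¹' {false}) = 1 - ν.real (X ⁻¹' S) := by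
    rw [← probReal_compl_eq_one_sub hS]
    congr 1
    ext
    simp [Z]
  have hmem : ∀ᵐ ω ∂ν, X ω ∈ bif Z ω then S else P := by
    filter_upwards [hP] with ω hω
    by_cases h : X ω ∈ S <;> simp [Z, h, hω]
  have hZuniv : ∀ᵐ ω ∂ν, Z ω ∈ Finset.univ := .of_forall fun ω => Finset.mem_univ _
  calc shannonEntropy ν X
      ≤ shannonEntropy ν Z + ∑ b, ν.real (Z ⁻¹' {b}) * log (bif b then S else P).card :=
        shannonEntropy_le_add_sum_mul_log_card hZ hX hZuniv (fun b => bif b then S else P) hmem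
    _ ≤ log 2 + ∑ b, ν.real (Z ⁻¹' {b}) * log (bif b then S else P).card := by
        gcongr
        simpa using shannonEntropy_le_log_card hZ hZuniv
    _ = _ := by simp [htrue, hfalse]

theorem measureReal_preimage_mul_neg_log_le [IsProbabilityMeasure ν] (hX : Measurable X)
    (hP : ∀ᵐ ω ∂ν, X ω ∈ P) (S : Finset α) {q M δ : ℝ} (hq : 0 < q) (hM : 1 ≤ M)
    (hH : -log q ≤ shannonEntropy ν X) (hcardP : P.card * q ≤ M) (hcardS : S.card * q ≤ δ) :
    ν.real (X ⁻¹' S) * -log δ ≤ log 2 + log M := by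
  have log_card_le : ∀ (R : Finset α) {C : ℝ}, R.Nonempty → R.card * q ≤ C →
      log R.card ≤ log C - log q := by
    intro R C hR hC
    have hR0 : (0 : ℝ) < R.card := Nat.cast_pos.2 hR.card_pos
    have := log_le_log (mul_pos hR0 hq) hC
    rw [log_mul hR0.ne' hq.ne'] at this
    linarith
  set a := ν.real (X ⁻¹' S)
  have ha0 : 0 ≤ a := measureReal_nonneg
  have ha1 : a ≤ 1 := measureReal_le_one
  have hPne : P.Nonempty := by
    obtain ⟨ω, hω⟩ := hP.exists
    exact ⟨_, hω⟩
  have hS : a * log S.card ≤ a * (log δ - log q) := by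
    rcases S.eq_empty_or_nonempty with rfl | hS
    · simp [a]
    · exact mul_le_mul_of_nonneg_left (log_card_le S hS hcardS) ha0
  have hP' : (1 - a) * log P.card ≤ (1 - a) * (log M - log q) :=
    mul_le_mul_of_nonneg_left (log_card_le P hPne hcardP) (sub_nonneg.2 ha1)
  have haM : 0 ≤ a * log M := mul_nonneg ha0 (log_nonneg hM)
  linarith [shannonEntropy_le_log_two_add hX hP S]

end

end Entropy

section Dyadic

open Real

theorem mem_dyadicInterval_iff {n : ℕ} {k : ℤ} {x : ℝ} :
    x ∈ dyadicInterval n k ↔ ⌊2 ^ n * x⌋ = k := by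
  have h : (0 : ℝ) < 2 ^ n := by positivity
  rw [dyadicInterval, Set.mem_Ico, Int.floor_eq_iff, div_le_iff₀' h, lt_div_iff₀' h]

theorem scaleEntropy_map {Ω : Type*} [MeasurableSpace Ω] {ν : Measure Ω}
    [IsProbabilityMeasure ν] {X : Ω → ℝ} (hX : Measurable X) {n : ℕ} {P : Finset ℤ}
    (hP : ∀ᵐ ω ∂ν, ⌊2 ^ n * X ω⌋ ∈ P) :
    scaleEntropy (ν.map X) n =
      ENNReal.ofReal (shannonEntropy ν (fun ω => ⌊2 ^ n * X ω⌋) / log 2) := by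
  have hcell : ∀ k, (ν.map X).real (dyadicInterval n k) =
      ν.real ((fun ω => ⌊2 ^ n * X ω⌋) ⁻¹' {k}) := by
    intro k
    rw [map_measureReal_apply hX (show MeasurableSet (dyadicInterval n k) from measurableSet_Ico)]
    congr 1
    ext ω
    exact mem_dyadicInterval_iff
  have hterm : ∀ p : ℝ, -(p * logb 2 p) = negMulLog p / log 2 := fun p => by
    rw [negMulLog, logb]
    ring
  simp only [scaleEntropy, hcell, hterm]
  rw [tsum_eq_sum (s := P) fun k hk => by
      rw [measureReal_preimage_singleton_eq_zero hP hk, negMulLog_zero, zero_div,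
        ENNReal.ofReal_zero],
    shannonEntropy_eq_sum hP, Finset.sum_div, ENNReal.ofReal_sum_of_nonneg fun k _ =>
      div_nonneg (negMulLog_nonneg measureReal_nonneg measureReal_le_one) (log_nonneg one_le_two)]

theorem floor_mem_Icc_of_abs_sub_le {x y : ℝ} {N : ℕ} (h : |y - x| ≤ N) :
    ⌊y⌋ ∈ Finset.Icc (⌊x⌋ - N) (⌊x⌋ + N + 1) := by
  obtain ⟨hlow, hupp⟩ := abs_le.1 h
  refine Finset.mem_Icc.2 ⟨Int.le_floor.2 ?_, Int.lt_add_one_iff.1 (Int.floor_lt.2 ?_)⟩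
  · push_cast
    linarith [Int.floor_le x]
  · push_cast
    linarith [Int.lt_floor_add_one x]

end Dyadic

section Sequences

theorem le_of_mul_le_mul_add {a : ℕ → ℝ} {M : ℝ} (ha : ∀ n, 0 ≤ a n) (hM : 0 ≤ M)
    (hmul : ∀ m n, a m * a n ≤ M * a (m + n)) (hbdd : BddAbove (Set.range a)) (n : ℕ) :
    a n ≤ M := by
  have hsup : a n * ⨆ k, a k ≤ M * ⨆ k, a k := by
    rw [Real.mul_iSup_of_nonneg (ha n)]
    exact ciSup_le fun k =>
      (hmul n k).trans (mul_le_mul_of_nonneg_left (le_ciSup hbdd (n + k)) hM)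
  rcases (Real.iSup_nonneg ha).eq_or_lt with h | h
  · exact ((le_ciSup hbdd n).trans h.ge).trans hM
  · exact le_of_mul_le_mul_right hsup h

theorem bddAbove_range_of_le_sum_mul {ι : Type*} {J : Finset ι} {m : ι → ℕ} {w : ι → ℝ}
    {a : ℕ → ℝ} {N : ℕ} (ha : ∀ n, 0 ≤ a n) (hm : ∀ j ∈ J, 0 < m j ∧ m j ≤ N)
    (hw : ∀ j ∈ J, 0 ≤ w j) (hw1 : ∑ j ∈ J, w j ≤ 1)
    (hrec : ∀ n, N ≤ n → a n ≤ ∑ j ∈ J, a (n - m j) * w j) : BddAbove (Set.range a) := by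
  set B := ∑ k ∈ Finset.range N, a k
  have hB : 0 ≤ B := Finset.sum_nonneg fun k _ => ha k
  refine ⟨B, Set.forall_mem_range.2 fun n => ?_⟩
  induction n using Nat.strong_induction_on with
  | _ n ih =>
  rcases lt_or_ge n N with hn | hn
  · exact Finset.single_le_sum (fun k _ => ha k) (Finset.mem_range.2 hn)
  · calc a n ≤ ∑ j ∈ J, a (n - m j) * w j := hrec n hn
      _ ≤ ∑ j ∈ J, B * w j := Finset.sum_le_sum fun j hj => by
          obtain ⟨hm0, hmN⟩ := hm j hj
          exact mul_le_mul_of_nonneg_right (ih _ (by omega)) (hw j hj)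
      _ = B * ∑ j ∈ J, w j := (Finset.mul_sum ..).symm
      _ ≤ B := mul_le_of_le_one_right hB hw1

end Sequences

section HausdorffMeasure

theorem absolutelyContinuous_hausdorffMeasure_zero {X : Type*} [EMetricSpace X]
    [MeasurableSpace X] [BorelSpace X] (μ : Measure X) : μ ≪ μH[0] := by
  intro A hA
  rcases A.eq_empty_or_nonempty with rfl | hne
  · exact measure_empty
  · have := Measure.one_le_hausdorffMeasure_zero_of_nonempty hne
    simp [hA] at this

theorem absolutelyContinuous_of_forall_isCompact {X : Type*} [TopologicalSpace X]
    [MeasurableSpace X] {μ ν : Measure X} [μ.InnerRegular]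
    (h : ∀ A, IsCompact A → ν A = 0 → μ A = 0) : μ ≪ ν := by
  refine Measure.AbsolutelyContinuous.mk fun A hA hνA => ?_
  by_contra hμA
  obtain ⟨B, hBA, hB, hμB⟩ := hA.exists_lt_isCompact (pos_iff_ne_zero.2 hμA)
  exact hμB.ne' (h B hB (measure_mono_null hBA hνA))

theorem exists_ediam_cover_of_hausdorffMeasure_eq_zero {X : Type*} [EMetricSpace X]
    [MeasurableSpace X] [BorelSpace X] {t : ℝ} (ht : 0 < t) {A : Set X} (hA : μH[t] A = 0)
    {δ : ℝ≥0∞} (hδ : 0 < δ) :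
    ∃ V : ℕ → Set X, A ⊆ ⋃ n, V n ∧ (∀ n, Metric.ediam (V n) ≤ 1) ∧
      ∑' n, Metric.ediam (V n) ^ t < δ := by
  rw [Measure.hausdorffMeasure_apply, ENNReal.iSup_eq_zero] at hA
  have hlt := (ENNReal.iSup_eq_zero.1 (hA 1) one_pos).trans_lt hδ
  simp only [iInf_lt_iff] at hlt
  obtain ⟨V, hAV, hV1, hV⟩ := hlt
  refine ⟨V, hAV, hV1, (ENNReal.tsum_le_tsum fun n => ?_).trans_lt hV⟩
  rcases (V n).eq_empty_or_nonempty with h | h <;> simp [h, ht]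

theorem exists_le_pow_and_rpow_pow_le {r t d η : ℝ} (hr0 : 0 < r) (hr1 : r < 1) (ht : 0 < t)
    (hd0 : 0 ≤ d) (hd1 : d ≤ 1) (hη : 0 < η) :
    ∃ m : ℕ, d ≤ r ^ m ∧ (r ^ t) ^ m ≤ (r ^ t)⁻¹ * d ^ t + η := by
  have hρ : 0 < r ^ t := Real.rpow_pos_of_pos hr0 t
  rcases hd0.eq_or_lt with rfl | hd
  · obtain ⟨m, hm⟩ := exists_pow_lt_of_lt_one hη (Real.rpow_lt_one hr0.le hr1 ht)
    refine ⟨m, (pow_pos hr0 m).le, ?_⟩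
    rw [Real.zero_rpow ht.ne', mul_zero, zero_add]
    exact hm.le
  · obtain ⟨m, hlt, hle⟩ := exists_nat_pow_near_of_lt_one hd hd1 hr0 hr1
    have hpow : (r ^ t) ^ (m + 1) ≤ d ^ t := by
      rw [Real.rpow_pow_comm hr0.le]
      exact Real.rpow_le_rpow (pow_nonneg hr0.le _) hlt.le ht.le
    refine ⟨m, hle, le_add_of_le_of_nonneg ?_ hη.le⟩
    rwa [inv_mul_eq_div, le_div_iff₀ hρ, ← pow_succ]

theorem exists_subset_ball_of_ediam_le_one {X : Type*} [PseudoMetricSpace X] [Nonempty X]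
    {r t : ℝ} (hr0 : 0 < r) (hr1 : r < 1) (ht : 0 < t) {V : Set X} (hV : Metric.ediam V ≤ 1)
    {η : ℝ≥0} (hη : 0 < η) :
    ∃ p : X × ℕ, V ⊆ Metric.ball p.1 (2 * r ^ p.2) ∧
      ENNReal.ofReal ((r ^ t) ^ p.2) ≤
        ENNReal.ofReal (r ^ t)⁻¹ * Metric.ediam V ^ t + η := by
  have hfin : Metric.ediam V ≠ ∞ := (hV.trans_lt ENNReal.one_lt_top).ne
  obtain ⟨m, hm, hpow⟩ := exists_le_pow_and_rpow_pow_le hr0 hr1 ht ENNReal.toReal_nonneg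
    (ENNReal.toReal_le_of_le_ofReal zero_le_one (by simpa using hV)) (NNReal.coe_pos.2 hη)
  have hsize : ENNReal.ofReal ((r ^ t) ^ m) ≤
      ENNReal.ofReal (r ^ t)⁻¹ * Metric.ediam V ^ t + η := by
    refine (ENNReal.ofReal_le_ofReal hpow).trans_eq ?_
    rw [ENNReal.ofReal_add (by positivity) η.coe_nonneg, ENNReal.ofReal_mul (by positivity),
      ← ENNReal.ofReal_rpow_of_nonneg ENNReal.toReal_nonneg ht.le, ENNReal.ofReal_toReal hfin,
      ENNReal.ofReal_coe_nnreal]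
  obtain ⟨x, hx⟩ : ∃ x, V ⊆ Metric.ball x (2 * r ^ m) := by
    rcases V.eq_empty_or_nonempty with rfl | ⟨x, hx⟩
    · exact ⟨Classical.arbitrary X, Set.empty_subset _⟩
    · refine ⟨x, fun y hy => ?_⟩
      have hyx : (edist y x).toReal ≤ (Metric.ediam V).toReal :=
        ENNReal.toReal_mono hfin (Metric.edist_le_ediam_of_mem hy hx)
      rw [Metric.mem_ball, dist_edist]
      linarith [pow_pos hr0 m]
  exact ⟨(x, m), hx, hsize⟩

theorem exists_finset_cover_ball_of_hausdorffMeasure_eq_zero {X : Type*} [MetricSpace X]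
    [MeasurableSpace X] [BorelSpace X] {r t ε : ℝ} (hr0 : 0 < r) (hr1 : r < 1) (ht : 0 < t)
    (hε : 0 < ε) {A : Set X} (hA : IsCompact A) (hA0 : μH[t] A = 0) :
    ∃ J : Finset (X × ℕ),
      A ⊆ ⋃ p ∈ J, Metric.ball p.1 (2 * r ^ p.2) ∧ ∑ p ∈ J, (r ^ t) ^ p.2 ≤ ε := by
  classical
  rcases isEmpty_or_nonempty X with _ | _
  · exact ⟨∅, by simp [Set.eq_empty_of_isEmpty A], by simpa using hε.le⟩
  have hρ : 0 < r ^ t := Real.rpow_pos_of_pos hr0 t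
  obtain ⟨V, hAV, hV1, hV⟩ := exists_ediam_cover_of_hausdorffMeasure_eq_zero ht hA0
    (ENNReal.ofReal_pos.2 (show 0 < r ^ t * (ε / 2) by positivity))
  obtain ⟨η, hη0, hη⟩ := ENNReal.exists_pos_sum_of_countable
    (ENNReal.ofReal_pos.2 (half_pos hε)).ne' ℕ
  choose p hVp hp using fun n => exists_subset_ball_of_ediam_le_one hr0 hr1 ht (hV1 n) (hη0 n)
  obtain ⟨J, hJ⟩ := hA.elim_finite_subcover (fun n => Metric.ball (p n).1 (2 * r ^ (p n).2))
    (fun n => Metric.isOpen_ball) (hAV.trans (Set.iUnion_mono hVp))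
  refine ⟨J.image p, by simpa only [Finset.set_biUnion_finset_image] using hJ, ?_⟩
  refine (Finset.sum_image_le_of_nonneg fun _ _ => by positivity).trans ?_
  rw [← ENNReal.ofReal_le_ofReal_iff hε.le, ENNReal.ofReal_sum_of_nonneg fun _ _ => by positivity]
  calc ∑ n ∈ J, ENNReal.ofReal ((r ^ t) ^ (p n).2)
      ≤ ∑ n ∈ J, (ENNReal.ofReal (r ^ t)⁻¹ * Metric.ediam (V n) ^ t + η n) :=
        Finset.sum_le_sum fun n _ => hp n
    _ ≤ ENNReal.ofReal (r ^ t)⁻¹ * ∑' n, Metric.ediam (V n) ^ t + ∑' n, (η n : ℝ≥0∞) := by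
        rw [← ENNReal.tsum_mul_left, ← ENNReal.tsum_add]
        exact ENNReal.sum_le_tsum J
    _ ≤ ENNReal.ofReal (r ^ t)⁻¹ * ENNReal.ofReal (r ^ t * (ε / 2)) +
          ENNReal.ofReal (ε / 2) := by gcongr
    _ = ENNReal.ofReal ε := by
        rw [← ENNReal.ofReal_mul (by positivity), inv_mul_cancel_left₀ hρ.ne',
          ← ENNReal.ofReal_add (by positivity) (by positivity), add_halves]

end HausdorffMeasure

section Separated

theorem card_le_of_pairwise_lt_abs_sub {S : Finset ℝ} {x a η : ℝ} (hη : 0 < η)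
    (hsep : (S : Set ℝ).Pairwise fun y z => η < |y - z|) (hS : ∀ z ∈ S, |z - x| ≤ a * η) :
    S.card ≤ 2 * ⌈a⌉₊ + 1 := by
  have hcard : (Finset.Icc (-⌈a⌉₊ : ℤ) ⌈a⌉₊).card = 2 * ⌈a⌉₊ + 1 := by
    rw [Int.card_Icc]
    omega
  rw [← hcard]
  refine Finset.card_le_card_of_injOn (fun z => ⌊(z - x) / η⌋) (fun z hz => ?_)
    fun y hy z hz hyz => ?_
  · have habs : |(z - x) / η| ≤ ⌈a⌉₊ := by
      rw [abs_div, abs_of_pos hη]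
      exact ((div_le_iff₀ hη).2 (hS z hz)).trans (Nat.le_ceil a)
    obtain ⟨hlow, hupp⟩ := abs_le.1 habs
    refine Finset.mem_coe.2 (Finset.mem_Icc.2 ⟨Int.le_floor.2 ?_, ?_⟩)
    · push_cast
      exact hlow
    · exact_mod_cast (Int.floor_le _).trans hupp
  · by_contra hne
    have hlt := Int.abs_sub_lt_one_of_floor_eq_floor hyz
    rw [← sub_div, sub_sub_sub_cancel_right, abs_div, abs_of_pos hη, div_lt_one hη] at hlt
    exact lt_asymm hlt (hsep hy hz hne)

end Separated

namespace HomogeneousAffineIFS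

variable {Γ : Type*}

section Points

variable (F : HomogeneousAffineIFS Γ)

/-- The point `f_{i_1} ⋯ f_{i_n}(0)` reached from `0` by the first `n` letters of `i`. -/
noncomputable def prefixPoint (n : ℕ) (i : ℕ → Γ) : ℝ :=
  F.wordMap (List.ofFn fun j : Fin n => i j) 0

theorem prefixPoint_zero (i : ℕ → Γ) : F.prefixPoint 0 i = 0 := rfl

theorem prefixPoint_succ (n : ℕ) (i : ℕ → Γ) :
    F.prefixPoint (n + 1) i = F.ratio * F.prefixPoint n (leftShift i) + F.translation (i 0) := by
  rw [prefixPoint, List.ofFn_succ]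
  rfl

theorem prefixPoint_add (m n : ℕ) (i : ℕ → Γ) :
    F.prefixPoint (m + n) i =
      F.prefixPoint m i + F.ratio ^ m * F.prefixPoint n (leftShift^[m] i) := by
  induction m generalizing i with
  | zero => simp [prefixPoint_zero]
  | succ m ih =>
    rw [Nat.add_right_comm, prefixPoint_succ, ih, prefixPoint_succ, Function.iterate_succ_apply]
    ring

theorem exists_prefixPoint_add (m n : ℕ) (i j : ℕ → Γ) :
    ∃ k, F.prefixPoint (m + n) k = F.prefixPoint m i + F.ratio ^ m * F.prefixPoint n j := by
  induction m generalizing i with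
  | zero => exact ⟨j, by simp [prefixPoint_zero]⟩
  | succ m ih =>
    obtain ⟨k, hk⟩ := ih (leftShift i)
    refine ⟨fun l => Nat.casesOn l (i 0) k, ?_⟩
    rw [Nat.add_right_comm, prefixPoint_succ, prefixPoint_succ]
    change F.ratio * F.prefixPoint (m + n) k + F.translation (i 0) = _
    rw [hk]
    ring

theorem wordMap_apply (w : List Γ) (x : ℝ) :
    F.wordMap w x = F.wordMap w 0 + F.ratio ^ w.length * x := by
  induction w with
  | nil => simp [wordMap]
  | cons a w ih =>
    simp only [wordMap, Function.comp_apply, map, ih, List.length_cons]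
    ring

/-- The radius of an interval about `0` that each `f_i` maps into itself. -/
noncomputable def radius : ℝ := (⨆ i, |F.translation i|) / (1 - F.ratio)

theorem radius_nonneg : 0 ≤ F.radius :=
  div_nonneg (Real.iSup_nonneg fun _ => abs_nonneg _) (sub_nonneg.2 F.ratio_lt_one.le)

variable [Finite Γ]

theorem ratio_mul_radius_add_abs_translation_le (i : Γ) :
    F.ratio * F.radius + |F.translation i| ≤ F.radius := by
  have hsup : |F.translation i| ≤ F.radius * (1 - F.ratio) := by
    rw [radius, div_mul_cancel₀ _ (sub_pos.2 F.ratio_lt_one).ne']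
    exact le_ciSup (Set.finite_range fun i => |F.translation i|).bddAbove i
  linarith

theorem abs_prefixPoint_le (n : ℕ) (i : ℕ → Γ) : |F.prefixPoint n i| ≤ F.radius := by
  induction n generalizing i with
  | zero => simpa [prefixPoint_zero] using F.radius_nonneg
  | succ n ih =>
    calc |F.prefixPoint (n + 1) i|
        ≤ F.ratio * |F.prefixPoint n (leftShift i)| + |F.translation (i 0)| := by
          rw [prefixPoint_succ, ← abs_of_pos F.ratio_pos, ← abs_mul, abs_of_pos F.ratio_pos]
          exact abs_add_le _ _
      _ ≤ F.ratio * F.radius + |F.translation (i 0)| := by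
          gcongr
          · exact F.ratio_pos.le
          · exact ih _
      _ ≤ F.radius := F.ratio_mul_radius_add_abs_translation_le (i 0)

theorem abs_prefixPoint_add_sub_prefixPoint_le (m n : ℕ) (i : ℕ → Γ) :
    |F.prefixPoint (m + n) i - F.prefixPoint m i| ≤ F.radius * F.ratio ^ m := by
  have hr : 0 < F.ratio ^ m := pow_pos F.ratio_pos m
  rw [prefixPoint_add, add_sub_cancel_left, abs_mul, abs_of_pos hr, mul_comm]
  exact mul_le_mul_of_nonneg_right (F.abs_prefixPoint_le n _) hr.le

theorem abs_coding_sub_prefixPoint_le (n : ℕ) (i : ℕ → Γ) :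
    |F.coding i - F.prefixPoint n i| ≤ F.radius * F.ratio ^ n := by
  have hlim : Tendsto (fun k => F.prefixPoint (n + k) i) atTop (𝓝 (F.coding i)) :=
    (F.tendsto_coding i).comp (tendsto_atTop_mono (fun k => Nat.le_add_left k n) tendsto_id)
  exact le_of_tendsto' (hlim.sub_const _).abs
    fun k => F.abs_prefixPoint_add_sub_prefixPoint_le n k i

variable {F} in
theorem IsAttractor.coding_mem {K : Set ℝ} (hK : F.IsAttractor K) (i : ℕ → Γ) :
    F.coding i ∈ K := by
  obtain ⟨⟨x, hx⟩, hcompact, hinv⟩ := hK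
  have wordMap_mem : ∀ w, F.wordMap w x ∈ K := by
    intro w
    induction w with
    | nil => exact hx
    | cons a w ih =>
      rw [hinv]
      exact Set.mem_iUnion.2 ⟨a, _, ih, rfl⟩
  have hlim : Tendsto (fun n => F.prefixPoint n i + F.ratio ^ n * x) atTop
      (𝓝 (F.coding i + 0 * x)) :=
    (F.tendsto_coding i).add
      ((tendsto_pow_atTop_nhds_zero_of_lt_one F.ratio_pos.le F.ratio_lt_one).mul_const x)
  rw [zero_mul, add_zero] at hlim
  refine hcompact.isClosed.mem_of_tendsto hlim (.of_forall fun n => ?_)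
  have := wordMap_mem (List.ofFn fun j : Fin n => i j)
  rwa [wordMap_apply, List.length_ofFn] at this

theorem finite_range_prefixPoint (n : ℕ) : (Set.range (F.prefixPoint n)).Finite :=
  (Set.finite_range fun u : Fin n → Γ => F.wordMap (List.ofFn u) 0).subset
    (Set.range_subset_iff.2 fun i => ⟨fun j => i j, rfl⟩)

/-- The set of all points `f_u(0)`, where `u` is a word of length `n`. -/
noncomputable def points (n : ℕ) : Finset ℝ :=
  (F.finite_range_prefixPoint n).toFinset

variable {F} in
theorem mem_points {n : ℕ} {x : ℝ} : x ∈ F.points n ↔ ∃ i, F.prefixPoint n i = x := by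
  simp [points]

theorem prefixPoint_mem_points (n : ℕ) (i : ℕ → Γ) : F.prefixPoint n i ∈ F.points n :=
  mem_points.2 ⟨i, rfl⟩

variable {F} in
theorem add_mem_points {m n : ℕ} {x y : ℝ} (hx : x ∈ F.points m) (hy : y ∈ F.points n) :
    x + F.ratio ^ m * y ∈ F.points (m + n) := by
  obtain ⟨i, rfl⟩ := mem_points.1 hx
  obtain ⟨j, rfl⟩ := mem_points.1 hy
  exact mem_points.2 (F.exists_prefixPoint_add m n i j)

/-- The points of level `n` that are reached on the way to a point of `A`: those `f_u(0)`, for `u`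
of length `n`, such that some continuation of `u` codes a point of `A`. -/
noncomputable def pointsOver (n : ℕ) (A : Set ℝ) : Finset ℝ :=
  ((F.finite_range_prefixPoint n).subset (Set.image_subset_range _ (F.coding ⁻¹' A))).toFinset

variable {F} in
theorem mem_pointsOver {n : ℕ} {A : Set ℝ} {x : ℝ} :
    x ∈ F.pointsOver n A ↔ ∃ i, F.coding i ∈ A ∧ F.prefixPoint n i = x := by
  simp [pointsOver]

variable {F} in
theorem pointsOver_eq_points {A : Set ℝ} (hA : ∀ i, F.coding i ∈ A) (n : ℕ) :
    F.pointsOver n A = F.points n := by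
  ext x
  simp [mem_pointsOver, mem_points, hA]

end Points

section WeakSeparation

variable [Finite Γ] {F : HomogeneousAffineIFS Γ}

theorem WeakSeparation.exists_pairwise_points (hF : F.WeakSeparation) :
    ∃ c : ℝ, 0 < c ∧
      ∀ n, (F.points n : Set ℝ).Pairwise fun x y => c * F.ratio ^ n < |x - y| := by
  obtain ⟨c, hc, h⟩ := hF
  refine ⟨c, hc, fun n x hx y hy hxy => ?_⟩
  obtain ⟨i, rfl⟩ := mem_points.1 hx
  obtain ⟨j, rfl⟩ := mem_points.1 hy
  rcases n.eq_zero_or_pos with rfl | hn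
  · exact absurd rfl hxy
  · exact (h n hn _ _).resolve_left (abs_ne_zero.2 (sub_ne_zero.2 hxy))

theorem WeakSeparation.exists_card_points_near_le (hF : F.WeakSeparation) (a : ℝ) :
    ∃ M : ℕ, 0 < M ∧ ∀ n x, {z ∈ F.points n | |z - x| ≤ a * F.ratio ^ n}.card ≤ M := by
  obtain ⟨c, hc, hsep⟩ := hF.exists_pairwise_points
  refine ⟨2 * ⌈a / c⌉₊ + 1, Nat.succ_pos _, fun n x => ?_⟩
  refine card_le_of_pairwise_lt_abs_sub (x := x) (mul_pos hc (pow_pos F.ratio_pos n))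
    ((hsep n).mono (Finset.coe_subset.2 (Finset.filter_subset _ _))) fun z hz => ?_
  rw [← mul_assoc, div_mul_cancel₀ a hc.ne']
  exact (Finset.mem_filter.1 hz).2

theorem WeakSeparation.exists_card_points_mul_le (hF : F.WeakSeparation) :
    ∃ M : ℕ, 0 < M ∧ ∀ m n,
      (F.points m).card * (F.points n).card ≤ M * (F.points (m + n)).card := by
  obtain ⟨M, hM0, hM⟩ := hF.exists_card_points_near_le F.radius
  refine ⟨M, hM0, fun m n => ?_⟩
  have hr : 0 < F.ratio ^ m := pow_pos F.ratio_pos m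
  rw [← Finset.card_product]
  refine Finset.card_le_mul_card_image_of_maps_to (f := fun p : ℝ × ℝ => p.1 + F.ratio ^ m * p.2)
    (fun p hp => add_mem_points (Finset.mem_product.1 hp).1 (Finset.mem_product.1 hp).2) M
    fun z _ => (Finset.card_le_card_of_injOn Prod.fst (fun p hp => ?_) ?_).trans (hM m z)
  · obtain ⟨hp', rfl⟩ := Finset.mem_filter.1 hp
    obtain ⟨hp1, hp2⟩ := Finset.mem_product.1 hp'
    obtain ⟨j, hj⟩ := mem_points.1 hp2
    refine Finset.mem_coe.2 (Finset.mem_filter.2 ⟨hp1, ?_⟩)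
    rw [sub_add_cancel_left, abs_neg, abs_mul, abs_of_pos hr, mul_comm, ← hj]
    exact mul_le_mul_of_nonneg_right (F.abs_prefixPoint_le n j) hr.le
  · intro p hp q hq hpq
    have hsum := (Finset.mem_filter.1 hp).2.trans (Finset.mem_filter.1 hq).2.symm
    simp only [hpq, add_right_inj] at hsum
    exact Prod.ext hpq (mul_left_cancel₀ hr.ne' hsum)

theorem WeakSeparation.exists_card_points_near_le_mul (hF : F.WeakSeparation) (a : ℝ) :
    ∃ M : ℕ, 0 < M ∧ ∀ m n x, m ≤ n →
      {z ∈ F.points n | |z - x| ≤ a * F.ratio ^ m}.card ≤ M * (F.points (n - m)).card := by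
  obtain ⟨M, hM0, hM⟩ := hF.exists_card_points_near_le (F.radius + a)
  refine ⟨M, hM0, fun m n x hmn => ?_⟩
  obtain ⟨k, rfl⟩ := Nat.exists_eq_add_of_le hmn
  rw [Nat.add_sub_cancel_left]
  refine le_trans ?_ (Nat.mul_le_mul_right _ (hM m x))
  rw [← Finset.card_product]
  refine (Finset.card_le_card fun z hz => ?_).trans
    (Finset.card_image_le (f := fun p : ℝ × ℝ => p.1 + F.ratio ^ m * p.2))
  obtain ⟨hz, hzx⟩ := Finset.mem_filter.1 hz
  obtain ⟨i, rfl⟩ := mem_points.1 hz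
  have hnear : |F.prefixPoint m i - x| ≤ (F.radius + a) * F.ratio ^ m := by
    have hdist := F.abs_prefixPoint_add_sub_prefixPoint_le m k i
    rw [abs_sub_comm] at hdist
    rw [add_mul]
    exact (abs_sub_le _ _ _).trans (add_le_add hdist hzx)
  exact Finset.mem_image.2 ⟨(F.prefixPoint m i, F.prefixPoint k (leftShift^[m] i)),
    Finset.mem_product.2 ⟨Finset.mem_filter.2 ⟨F.prefixPoint_mem_points m i, hnear⟩,
      F.prefixPoint_mem_points k _⟩, (F.prefixPoint_add m k i).symm⟩

theorem WeakSeparation.exists_card_pointsOver_le_sum (hF : F.WeakSeparation) :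
    ∃ M : ℕ, 0 < M ∧ ∀ (A : Set ℝ) (J : Finset (ℝ × ℕ)) (n : ℕ),
      A ⊆ ⋃ p ∈ J, Metric.ball p.1 (2 * F.ratio ^ p.2) → (∀ p ∈ J, p.2 ≤ n) →
      (F.pointsOver n A).card ≤ M * ∑ p ∈ J, (F.points (n - p.2)).card := by
  classical
  obtain ⟨M, hM0, hM⟩ := hF.exists_card_points_near_le_mul (F.radius + 2)
  refine ⟨M, hM0, fun A J n hA hJ => ?_⟩
  rw [Finset.mul_sum]
  refine (Finset.card_le_card fun z hz => ?_).trans (Finset.card_biUnion_le.trans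
    (Finset.sum_le_sum fun p hp => hM p.2 n p.1 (hJ p hp)))
  obtain ⟨i, hi, rfl⟩ := mem_pointsOver.1 hz
  obtain ⟨p, hp, hip⟩ := Set.mem_iUnion₂.1 (hA hi)
  refine Finset.mem_biUnion.2 ⟨p, hp, Finset.mem_filter.2 ⟨F.prefixPoint_mem_points n i, ?_⟩⟩
  have hdist : |F.prefixPoint n i - F.coding i| ≤ F.radius * F.ratio ^ p.2 := by
    rw [abs_sub_comm]
    exact (F.abs_coding_sub_prefixPoint_le n i).trans (mul_le_mul_of_nonneg_left
      (pow_le_pow_of_le_one F.ratio_pos.le F.ratio_lt_one.le (hJ p hp)) F.radius_nonneg)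
  rw [add_mul]
  exact (abs_sub_le _ _ _).trans (add_le_add hdist hip.le)

theorem WeakSeparation.exists_card_pointsOver_mul_pow_le_sum (hF : F.WeakSeparation) :
    ∃ M : ℝ, 0 < M ∧ ∀ (A : Set ℝ) (J : Finset (ℝ × ℕ)) (n : ℕ) (ρ : ℝ), 0 ≤ ρ →
      A ⊆ ⋃ p ∈ J, Metric.ball p.1 (2 * F.ratio ^ p.2) → (∀ p ∈ J, p.2 ≤ n) →
      (F.pointsOver n A).card * ρ ^ n ≤
        ∑ p ∈ J, (F.points (n - p.2)).card * ρ ^ (n - p.2) * (M * ρ ^ p.2) := by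
  obtain ⟨M, hM0, hM⟩ := hF.exists_card_pointsOver_le_sum
  refine ⟨M, Nat.cast_pos.2 hM0, fun A J n ρ hρ hA hJ => ?_⟩
  have hcard : ((F.pointsOver n A).card : ℝ) ≤ M * ∑ p ∈ J, ((F.points (n - p.2)).card : ℝ) := by
    exact_mod_cast hM A J n hA hJ
  refine (mul_le_mul_of_nonneg_right hcard (pow_nonneg hρ n)).trans_eq ?_
  rw [Finset.mul_sum, Finset.sum_mul]
  refine Finset.sum_congr rfl fun p hp => ?_
  rw [← pow_sub_mul_pow ρ (hJ p hp)]
  ring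

end WeakSeparation

section Growth

variable [Finite Γ] {F : HomogeneousAffineIFS Γ}

theorem WeakSeparation.bddAbove_range_card_points_mul_pow (hF : F.WeakSeparation) {K : Set ℝ}
    (hK : IsCompact K) (hcoding : ∀ i, F.coding i ∈ K) {t : ℝ} (ht : 0 < t) (hK0 : μH[t] K = 0) :
    BddAbove (Set.range fun n => (F.points n).card * (F.ratio ^ t) ^ n) := by
  obtain ⟨M, hM0, hM⟩ := hF.exists_card_pointsOver_mul_pow_le_sum
  have hρ : 0 < F.ratio ^ t := Real.rpow_pos_of_pos F.ratio_pos t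
  obtain ⟨J, hKJ, hJ⟩ := exists_finset_cover_ball_of_hausdorffMeasure_eq_zero
    F.ratio_pos F.ratio_lt_one ht (inv_pos.2 (by positivity : 0 < M + 1)) hK hK0
  have hpos : ∀ p ∈ J, 0 < p.2 := by
    intro p hp
    by_contra! h
    have hle := (Finset.single_le_sum (fun p _ => (pow_pos hρ p.2).le) hp).trans hJ
    rw [Nat.le_zero.1 h, pow_zero] at hle
    exact hle.not_gt (inv_lt_one_of_one_lt₀ (lt_add_of_pos_left 1 hM0))
  have hweights : ∑ p ∈ J, M * (F.ratio ^ t) ^ p.2 ≤ 1 := by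
    rw [← Finset.mul_sum]
    refine (mul_le_mul_of_nonneg_left hJ hM0.le).trans ?_
    rw [← div_eq_mul_inv]
    exact div_le_one_of_le₀ (by linarith) (by linarith)
  refine bddAbove_range_of_le_sum_mul (m := Prod.snd) (N := J.sup Prod.snd)
    (fun n => by positivity) (fun p hp => ⟨hpos p hp, Finset.le_sup hp⟩)
    (fun p _ => by positivity) hweights fun n hn => ?_
  rw [← pointsOver_eq_points hcoding n]
  exact hM K J n _ hρ.le hKJ fun p hp => (Finset.le_sup hp).trans hn

theorem WeakSeparation.exists_card_points_mul_pow_le (hF : F.WeakSeparation) {K : Set ℝ}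
    (hK : IsCompact K) (hcoding : ∀ i, F.coding i ∈ K) {s : ℝ≥0} (hs : dimH K ≤ s) :
    ∃ M : ℝ, 1 ≤ M ∧ ∀ n, (F.points n).card * (F.ratio ^ (s : ℝ)) ^ n ≤ M := by
  obtain ⟨M, hM0, hM⟩ := hF.exists_card_points_mul_le
  have bound_of_lt : ∀ t : ℝ≥0, s < t →
      ∀ n, (F.points n).card * (F.ratio ^ (t : ℝ)) ^ n ≤ (M : ℝ) := by
    intro t hst
    have hρ : 0 < F.ratio ^ (t : ℝ) := Real.rpow_pos_of_pos F.ratio_pos t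
    refine le_of_mul_le_mul_add (fun n => by positivity) M.cast_nonneg (fun m n => ?_)
      (hF.bddAbove_range_card_points_mul_pow hK hcoding (NNReal.coe_pos.2 (pos_of_gt hst))
        (hausdorffMeasure_of_dimH_lt (hs.trans_lt (ENNReal.coe_lt_coe.2 hst))))
    rw [mul_mul_mul_comm, ← pow_add, ← mul_assoc]
    exact mul_le_mul_of_nonneg_right (by exact_mod_cast hM m n) (pow_nonneg hρ.le _)
  refine ⟨M, Nat.one_le_cast.2 hM0, fun n => ?_⟩
  have hcont : Continuous fun t : ℝ≥0 => (F.points n).card * (F.ratio ^ (t : ℝ)) ^ n :=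
    continuous_const.mul
      ((continuous_const.rpow NNReal.continuous_coe fun _ => Or.inl F.ratio_pos.ne').pow n)
  refine le_of_tendsto ((hcont.tendsto s).mono_left (nhdsWithin_le_nhds (s := Set.Ioi s))) ?_
  filter_upwards [self_mem_nhdsWithin] with t ht using bound_of_lt t ht n

theorem WeakSeparation.exists_card_pointsOver_mul_pow_le (hF : F.WeakSeparation) {t B : ℝ}
    (ht : 0 < t) (hB0 : 0 < B) (hB : ∀ n, (F.points n).card * (F.ratio ^ t) ^ n ≤ B) {A : Set ℝ}
    (hA : IsCompact A) (hA0 : μH[t] A = 0) {δ : ℝ} (hδ : 0 < δ) :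
    ∃ n, (F.pointsOver n A).card * (F.ratio ^ t) ^ n ≤ δ := by
  obtain ⟨M, hM0, hM⟩ := hF.exists_card_pointsOver_mul_pow_le_sum
  have hρ : 0 < F.ratio ^ t := Real.rpow_pos_of_pos F.ratio_pos t
  have hBM : 0 < B * M := mul_pos hB0 hM0
  obtain ⟨J, hAJ, hJ⟩ := exists_finset_cover_ball_of_hausdorffMeasure_eq_zero
    F.ratio_pos F.ratio_lt_one ht (div_pos hδ hBM) hA hA0
  refine ⟨J.sup Prod.snd, ?_⟩
  calc (F.pointsOver (J.sup Prod.snd) A).card * (F.ratio ^ t) ^ J.sup Prod.snd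
      ≤ ∑ p ∈ J, (F.points (J.sup Prod.snd - p.2)).card *
          (F.ratio ^ t) ^ (J.sup Prod.snd - p.2) * (M * (F.ratio ^ t) ^ p.2) :=
        hM A J _ _ hρ.le hAJ fun p hp => Finset.le_sup hp
    _ ≤ ∑ p ∈ J, B * (M * (F.ratio ^ t) ^ p.2) := by
        gcongr
        exact hB _
    _ = B * M * ∑ p ∈ J, (F.ratio ^ t) ^ p.2 := by
        simp only [Finset.mul_sum, mul_assoc]
    _ ≤ B * M * (δ / (B * M)) := by gcongr
    _ = δ := mul_div_cancel₀ δ hBM.ne'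

end Growth

section PointEntropy

open Real

variable [MeasurableSpace Γ] (F : HomogeneousAffineIFS Γ)

/-- The entropy, in nats, of the position `f_{i_1} ⋯ f_{i_n}(0)` of a `ν`-random sequence `i`. -/
noncomputable def pointEntropy (ν : Measure (ℕ → Γ)) (n : ℕ) : ℝ :=
  shannonEntropy ν (F.prefixPoint n)

variable {ν : Measure (ℕ → Γ)} [IsProbabilityMeasure ν]

theorem pointEntropy_nonneg (n : ℕ) : 0 ≤ F.pointEntropy ν n :=
  shannonEntropy_nonneg

theorem bddBelow_range_pointEntropy_div :
    BddBelow (Set.range fun n : ℕ => F.pointEntropy ν n / n) :=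
  ⟨0, Set.forall_mem_range.2 fun n => div_nonneg (F.pointEntropy_nonneg n) n.cast_nonneg⟩

variable [DiscreteMeasurableSpace Γ]

theorem measurable_prefixPoint (n : ℕ) : Measurable (F.prefixPoint n) := by
  simp only [funext fun i => show F.prefixPoint n i = _ from F.wordMap_ofFn i n]
  exact Finset.measurable_fun_sum _ fun j _ => Measurable.mul_const
    ((Measurable.of_discrete (f := F.translation)).comp (measurable_pi_apply j)) _

variable [Finite Γ]

theorem subadditive_pointEntropy (hν : MeasurePreserving leftShift ν ν) :
    Subadditive (F.pointEntropy ν) := by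
  intro m n
  have hshift := hν.iterate m
  have hX := F.measurable_prefixPoint m
  have hY : Measurable (F.prefixPoint n ∘ leftShift^[m]) :=
    (F.measurable_prefixPoint n).comp hshift.measurable
  have hP : ∀ᵐ i ∂ν, F.prefixPoint m i ∈ F.points m := .of_forall (F.prefixPoint_mem_points m)
  have hQ : ∀ᵐ i ∂ν, F.prefixPoint n (leftShift^[m] i) ∈ F.points n :=
    .of_forall fun i => F.prefixPoint_mem_points n _
  have hPQ : ∀ᵐ i ∂ν, (F.prefixPoint m i, F.prefixPoint n (leftShift^[m] i)) ∈
      F.points m ×ˢ F.points n := by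
    filter_upwards [hP, hQ] with i hi hi' using Finset.mk_mem_product hi hi'
  calc F.pointEntropy ν (m + n)
      = shannonEntropy ν fun i =>
          F.prefixPoint m i + F.ratio ^ m * F.prefixPoint n (leftShift^[m] i) := by
        rw [pointEntropy, funext (F.prefixPoint_add m n)]
    _ ≤ shannonEntropy ν fun i => (F.prefixPoint m i, F.prefixPoint n (leftShift^[m] i)) :=
        shannonEntropy_comp_le (hX.prodMk hY) hPQ fun p => p.1 + F.ratio ^ m * p.2
    _ ≤ F.pointEntropy ν m + shannonEntropy ν (F.prefixPoint n ∘ leftShift^[m]) :=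
        shannonEntropy_prodMk_le_add hX hY hP hQ
    _ = F.pointEntropy ν m + F.pointEntropy ν n := by
        rw [shannonEntropy_comp_measurePreserving hshift (F.measurable_prefixPoint n)]
        rfl

variable (ν) in
theorem exists_scaleEntropy_map_coding_le :
    ∃ C : ℝ, ∀ n k : ℕ, F.ratio ^ n * 2 ^ k ≤ 1 →
      scaleEntropy (ν.map F.coding) k ≤ ENNReal.ofReal ((F.pointEntropy ν n + C) / log 2) := by
  set N := ⌈F.radius⌉₊
  refine ⟨log (2 * N + 2 : ℕ), fun n k hnk => ?_⟩
  set T : ℝ → Finset ℤ := fun x => Finset.Icc (⌊2 ^ k * x⌋ - N) (⌊2 ^ k * x⌋ + N + 1)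
  have hT : ∀ i, ⌊2 ^ k * F.coding i⌋ ∈ T (F.prefixPoint n i) := by
    intro i
    refine floor_mem_Icc_of_abs_sub_le ?_
    calc |2 ^ k * F.coding i - 2 ^ k * F.prefixPoint n i|
        = 2 ^ k * |F.coding i - F.prefixPoint n i| := by
          rw [← mul_sub, abs_mul, abs_of_pos (by positivity : (0 : ℝ) < 2 ^ k)]
      _ ≤ 2 ^ k * (F.radius * F.ratio ^ n) := by
          gcongr
          exact F.abs_coding_sub_prefixPoint_le n i
      _ = F.radius * (F.ratio ^ n * 2 ^ k) := by ring
      _ ≤ F.radius := mul_le_of_le_one_right F.radius_nonneg hnk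
      _ ≤ N := Nat.le_ceil _
  have hcells : ∀ᵐ i ∂ν, ⌊2 ^ k * F.coding i⌋ ∈ (F.points n).biUnion T :=
    .of_forall fun i => Finset.mem_biUnion.2 ⟨_, F.prefixPoint_mem_points n i, hT i⟩
  rw [scaleEntropy_map F.measurable_coding hcells]
  refine ENNReal.ofReal_le_ofReal (div_le_div_of_nonneg_right ?_ (log_nonneg one_le_two))
  refine shannonEntropy_le_add_log (F.measurable_prefixPoint n)
    (Int.measurable_floor.comp (F.measurable_coding.const_mul _))
    (.of_forall (F.prefixPoint_mem_points n)) T (.of_forall hT) fun x => ?_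
  simp only [T, Int.card_Icc]
  omega

variable {F}

theorem entropyDim_map_coding_le (hν : MeasurePreserving leftShift ν ν) :
    entropyDim (ν.map F.coding) ≤
      ENNReal.ofReal ((F.subadditive_pointEntropy hν).lim / -log F.ratio) := by
  obtain ⟨C, hC⟩ := F.exists_scaleEntropy_map_coding_le ν
  have hL : 0 < -log F.ratio := neg_pos.2 (log_neg F.ratio_pos F.ratio_lt_one)
  have hlog2 : 0 < log 2 := log_pos one_lt_two
  set N : ℕ → ℕ := fun k => ⌈log 2 / -log F.ratio * k⌉₊
  have hN : ∀ k, F.ratio ^ N k * 2 ^ k ≤ 1 := by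
    intro k
    have hceil : log 2 / -log F.ratio * k ≤ N k := Nat.le_ceil _
    rw [div_mul_eq_mul_div, div_le_iff₀ hL] at hceil
    have hr : 0 < F.ratio ^ N k := pow_pos F.ratio_pos _
    rw [← log_nonpos_iff (by positivity), log_mul hr.ne' (by positivity), log_pow, log_pow]
    linarith
  have hNk : Tendsto (fun k : ℕ => (N k : ℝ) / k) atTop (𝓝 (log 2 / -log F.ratio)) :=
    (tendsto_nat_ceil_mul_div_atTop (div_pos hlog2 hL).le).comp tendsto_natCast_atTop_atTop
  have hNtop : Tendsto N atTop atTop := tendsto_nat_ceil_atTop.comp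
    (tendsto_natCast_atTop_atTop.const_mul_atTop (div_pos hlog2 hL))
  have hrate := ((F.subadditive_pointEntropy hν).tendsto_lim
    F.bddBelow_range_pointEntropy_div).comp hNtop
  have hlim : Tendsto (fun k : ℕ => (F.pointEntropy ν (N k) + C) / log 2 / k) atTop
      (𝓝 ((F.subadditive_pointEntropy hν).lim / -log F.ratio)) := by
    have := ((hrate.mul hNk).add (tendsto_const_div_atTop_nhds_zero_nat C)).div_const (log 2)
    rw [add_zero, mul_div_assoc, div_div_cancel_left' hlog2.ne', ← div_eq_mul_inv] at this
    refine this.congr' ?_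
    filter_upwards [hNtop.eventually_gt_atTop 0] with k hk
    simp only [Function.comp_apply]
    field_simp
  refine (liminf_le_liminf ?_).trans_eq (ENNReal.tendsto_ofReal hlim).liminf_eq
  filter_upwards [eventually_gt_atTop 0] with k hk
  rw [ENNReal.ofReal_div_of_pos (Nat.cast_pos.2 hk), ENNReal.ofReal_natCast]
  exact ENNReal.div_le_div_right (hC _ k (hN k)) _

theorem neg_log_rpow_pow_le_pointEntropy (hν : MeasurePreserving leftShift ν ν) {s : ℝ≥0}
    (hs : s ≤ entropyDim (ν.map F.coding)) (n : ℕ) :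
    -log ((F.ratio ^ (s : ℝ)) ^ n) ≤ F.pointEntropy ν n := by
  set hsub := F.subadditive_pointEntropy hν
  have hL : 0 < -log F.ratio := neg_pos.2 (log_neg F.ratio_pos F.ratio_lt_one)
  have hlim0 : 0 ≤ hsub.lim := ge_of_tendsto' (hsub.tendsto_lim F.bddBelow_range_pointEntropy_div)
    fun n => div_nonneg (F.pointEntropy_nonneg n) n.cast_nonneg
  have hdim : (s : ℝ) * -log F.ratio ≤ hsub.lim := by
    have := hs.trans (entropyDim_map_coding_le hν)
    rwa [← ENNReal.ofReal_coe_nnreal, ENNReal.ofReal_le_ofReal_iff (by positivity),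
      le_div_iff₀ hL] at this
  rcases eq_or_ne n 0 with rfl | hn
  · simpa using F.pointEntropy_nonneg 0
  · have hle := hdim.trans (hsub.lim_le_div F.bddBelow_range_pointEntropy_div hn)
    rw [le_div_iff₀ (by positivity)] at hle
    rw [log_pow, log_rpow F.ratio_pos]
    linarith

end PointEntropy

theorem WeakSeparation.measure_preimage_coding_eq_zero [Finite Γ] [MeasurableSpace Γ]
    [DiscreteMeasurableSpace Γ] {F : HomogeneousAffineIFS Γ} (hF : F.WeakSeparation) {K : Set ℝ}
    (hK : IsCompact K) (hcoding : ∀ i, F.coding i ∈ K) {ν : Measure (ℕ → Γ)}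
    [IsProbabilityMeasure ν] (hν : MeasurePreserving leftShift ν ν) {s : ℝ≥0} (hs : 0 < s)
    (hdimK : dimH K ≤ s) (hdimν : s ≤ entropyDim (ν.map F.coding)) {A : Set ℝ} (hA : IsCompact A)
    (hA0 : μH[(s : ℝ)] A = 0) : ν (F.coding ⁻¹' A) = 0 := by
  obtain ⟨M, hM1, hM⟩ := hF.exists_card_points_mul_pow_le hK hcoding hdimK
  have hq : 0 < F.ratio ^ (s : ℝ) := Real.rpow_pos_of_pos F.ratio_pos _
  have mul_le : ∀ L : ℝ, 0 ≤ L → ν.real (F.coding ⁻¹' A) * L ≤ Real.log 2 + Real.log M := by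
    intro L hL
    obtain ⟨n, hn⟩ := hF.exists_card_pointsOver_mul_pow_le (NNReal.coe_pos.2 hs)
      (one_pos.trans_le hM1) hM hA hA0 (Real.exp_pos (-L))
    have hsub : F.coding ⁻¹' A ⊆ F.prefixPoint n ⁻¹' F.pointsOver n A := fun i hi =>
      mem_pointsOver.2 ⟨i, hi, rfl⟩
    have hconc := measureReal_preimage_mul_neg_log_le (F.measurable_prefixPoint n)
      (.of_forall (F.prefixPoint_mem_points n)) (F.pointsOver n A) (pow_pos hq n) hM1
      (neg_log_rpow_pow_le_pointEntropy hν hdimν n) (hM n) hn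
    rw [Real.log_exp, neg_neg] at hconc
    exact (mul_le_mul_of_nonneg_right (measureReal_mono hsub) hL).trans hconc
  rw [← measureReal_eq_zero_iff]
  by_contra hne
  have htop : Tendsto (fun L => ν.real (F.coding ⁻¹' A) * L) atTop atTop :=
    tendsto_id.const_mul_atTop (measureReal_nonneg.lt_of_ne' hne)
  obtain ⟨L, hL, hL0⟩ := ((htop.eventually_gt_atTop _).and (eventually_ge_atTop 0)).exists
  exact hL.not_ge (mul_le L hL0)

end HomogeneousAffineIFS

theorem mainTheorem10 {Γ : Type*} [Fintype Γ] [Nontrivial Γ]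
    [MeasurableSpace Γ] [DiscreteMeasurableSpace Γ]
    (F : HomogeneousAffineIFS Γ) (hF : F.WeakSeparation)
    (K : Set ℝ) (hK : F.IsAttractor K)
    (ν : Measure (ℕ → Γ)) [IsProbabilityMeasure ν] (hν : MeasurePreserving leftShift ν ν)
    (μ : Measure ℝ) (hμ : μ = ν.map F.coding)
    (s : ℝ≥0) (hdimμ : entropyDim μ = s) (hdimK : dimH K = s) :
    μ ≪ μH[(s : ℝ)] := by
  subst hμ
  rcases eq_zero_or_pos s with rfl | hs
  · exact absolutelyContinuous_hausdorffMeasure_zero _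
  have := Measure.isProbabilityMeasure_map (μ := ν) F.measurable_coding.aemeasurable
  refine absolutelyContinuous_of_forall_isCompact fun A hA hA0 => ?_
  rw [Measure.map_apply F.measurable_coding hA.measurableSet]
  exact hF.measure_preimage_coding_eq_zero hK.2.1 hK.coding_mem hν hs hdimK.le hdimμ.ge hA hA0
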